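/- Let $n, n_1$ be integers with $1 < n_1 < n-1$, let $a_1,\dots,a_n \in (-1,1)$, $\vec a_1=(a_1,\dots,a_{n_1})'$, $\vec a_2=(a_{n_1+1},\dots,a_n)'$, let $|\vartheta|<1$, and let $$R_\vartheta = \mathrm{Diag}(1-a_1^2,\dots,1-a_n^2) + \begin{pmatrix} \vec a_1\vec a_1' & \vartheta\,\vec a_1\vec a_2' \\ \vartheta\,\vec a_2\vec a_1' & \vec a_2\vec a_2'\end{pmatrix}.$$ For every real $\alpha>0$ the $\Gamma_n(\alpha,R_\vartheta)$-distribution exists and is unique, i.e. there is exactly one probability measure on $\mathbb{R}^n$ that is concentrated on $[0,\infty)^n$ and has the Laplace transform $\det(I_n+R_\vartheta T)^{-\alpha}$, $T=\mathrm{Diag}(t_1,\dots,t_n)$, $t_i\ge 0$. Let $(X_1,\dots,X_n)$ have this distribution and let $F(x)=P(X_1\le x_1,\dots,X_n\le x_n)$ be its cdf. Then $F$ is MTP$_2$ on $(0,\infty)^n$, i.e. $F>0$ there and $$F(x\vee y)\,F(x\wedge y)\ \ge\ F(x)\,F(y)\qquad\text{for all } x,y\in(0,\infty)^n,$$ where $\vee$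 and $\wedge$ are the componentwise maximum and minimum. Moreover, for all $b\in(0,\infty)^n$, all $x\in\mathbb{R}^n$ with $x_i\le b_i$ for every $i$, and all $\emptyset\ne I\subseteq\{1,\dots,n\}$, the events $A_i=\{X_i\le x_i\}$ and $B_i=\{X_i\le b_i\}$ satisfy $$\frac{P(\bigcap_{i=1}^n A_i)}{P(\bigcap_{i=1}^n B_i)} \ \ge\ \frac{P(\bigcap_{i\in I} A_i)\,P(\bigcap_{i\notin I} A_i)}{P(\bigcap_{i\in I} B_i)\,P(\bigcap_{i\notin I} B_i)},$$ and, if all $x_i>0$, equivalently $$\frac{P(\bigcap_{i=1}^n A_i)}{P(\bigcap_{i\in I} A_i)\,P(\bigcap_{i\notin I} A_i)} \ \ge\ \frac{P(\bigcap_{i=1}^n B_i)}{P(\bigcap_{i\in I} B_i)\,P(\bigcap_{i\notin I} B_i)}.$$ (An empty intersection of events has probability $1$.) -/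

import Mathlib

open MeasureTheory

noncomputable section

/-- The block matrix `R_ϑ = D + (a₁a₁ᵀ, ϑ a₁a₂ᵀ; ϑ a₂a₁ᵀ, a₂a₂ᵀ)` with
`D = Diag(1 - a₁², …, 1 - aₙ²)`; the first block consists of the first `n₁` indices. -/
def blockFactorCorr {n : ℕ} (n₁ : ℕ) (a : Fin n → ℝ) (ϑ : ℝ) : Matrix (Fin n) (Fin n) ℝ :=
  Matrix.diagonal (fun i => 1 - a i ^ 2) +
    Matrix.of fun (i j : Fin n) =>
      (if ((i : ℕ) < n₁ ↔ (j : ℕ) < n₁) then 1 else ϑ) * (a i * a j)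

/-- `μ` is the `Γ_n(α, R)`-distribution (in the sense of Krishnamoorthy and Parthasarathy): a
probability measure on the nonnegative orthant with Laplace transform
`det(I + R T) ^ (-α)`, `T = Diag(t₁, …, tₙ)`, `t_i ≥ 0`. -/
structure IsMultivariateGamma {n : ℕ} (α : ℝ) (R : Matrix (Fin n) (Fin n) ℝ)
    (μ : Measure (Fin n → ℝ)) : Prop where
  isProbabilityMeasure : IsProbabilityMeasure μ
  ae_nonneg : ∀ᵐ x ∂μ, ∀ i, 0 ≤ x i
  laplace : ∀ t : Fin n → ℝ, (∀ i, 0 ≤ t i) →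
    ∫ x, Real.exp (-∑ i, t i * x i) ∂μ = (1 + R * Matrix.diagonal t).det ^ (-α)

/-- The joint cdf `F(x) = P(X₁ ≤ x₁, …, Xₙ ≤ xₙ)` of a distribution on `ℝⁿ`. -/
def jointCdf {n : ℕ} (μ : Measure (Fin n → ℝ)) (x : Fin n → ℝ) : ℝ :=
  μ.real {ω | ∀ i, ω i ≤ x i}

/-- `P(⋂_{i ∈ I} {X_i ≤ x_i})`. -/
def partialCdf {n : ℕ} (μ : Measure (Fin n → ℝ)) (I : Finset (Fin n)) (x : Fin n → ℝ) : ℝ :=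
  μ.real {ω | ∀ i ∈ I, ω i ≤ x i}

/-- `F` is multivariate totally positive of order 2 on `D`: it is everywhere positive on `D` and
`F(x ∨ y) F(x ∧ y) ≥ F(x) F(y)` for all `x, y ∈ D`, with componentwise maxima and minima.
(Used for `D` a product of intervals.) -/
def IsMTP2On {n : ℕ} (D : Set (Fin n → ℝ)) (F : (Fin n → ℝ) → ℝ) : Prop :=
  (∀ x ∈ D, 0 < F x) ∧ ∀ x ∈ D, ∀ y ∈ D, F x * F y ≤ F (x ⊔ y) * F (x ⊓ y)

end

open ProbabilityTheory
open scoped ENNReal NNReal BoundedContinuousFunction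

/-!
Conditionally on a family of random indices in `ℕ`, the coordinates are independent gamma variables
whose shape parameters are shifted by those indices; the two blocks are coupled only through one
index that they share. Since `Γ` is log-convex, the weights of this mixture are log-supermodular,
and the mass that a gamma law gives to a lower set is totally positive of order two in the shape and
the set. The four functions theorem sums out the indices, so the mass of a product of lower sets is
log-supermodular in the sets. On finite boxes this is the MTP₂ inequality; with some of the sides
infinite it gives the product inequality. The mixture has the right Laplace transform because the
series of its weights reassembles `det (I + R T) ^ (-α)`, and the Laplace transform determines the
law because the exponentials span a point-separating algebra.
-/

/-! ### Log-supermodular functions -/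

/-- Log-supermodularity of a real function on a lattice; on a product of two chains this is total
positivity of order two, and for a distribution function on `ℝⁿ` it is the inequality in MTP₂. -/
def LogSupermodular {L : Type*} [Lattice L] (F : L → ℝ) : Prop :=
  ∀ x y, F x * F y ≤ F (x ⊓ y) * F (x ⊔ y)

namespace LogSupermodular

variable {L M : Type*}

lemma comp [Lattice L] [Lattice M] {F : L → ℝ} (hF : LogSupermodular F) {g : M → L}
    (map_inf : ∀ x y, g (x ⊓ y) = g x ⊓ g y) (map_sup : ∀ x y, g (x ⊔ y) = g x ⊔ g y) :
    LogSupermodular fun x => F (g x) := fun x y => by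
  simpa only [map_inf, map_sup] using hF (g x) (g y)

lemma mul [Lattice L] {F G : L → ℝ} (hF : LogSupermodular F) (hG : LogSupermodular G)
    (F_nonneg : ∀ x, 0 ≤ F x) (G_nonneg : ∀ x, 0 ≤ G x) :
    LogSupermodular fun x => F x * G x := fun x y => calc
  F x * G x * (F y * G y) = F x * F y * (G x * G y) := by ring
  _ ≤ F (x ⊓ y) * F (x ⊔ y) * (G (x ⊓ y) * G (x ⊔ y)) :=
    mul_le_mul (hF x y) (hG x y) (mul_nonneg (G_nonneg _) (G_nonneg _))
      (mul_nonneg (F_nonneg _) (F_nonneg _))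
  _ = F (x ⊓ y) * G (x ⊓ y) * (F (x ⊔ y) * G (x ⊔ y)) := by ring

lemma prod {ι : Type*} [Fintype ι] [Lattice L] {F : ι → L → ℝ}
    (hF : ∀ i, LogSupermodular (F i)) (F_nonneg : ∀ i x, 0 ≤ F i x) :
    LogSupermodular fun x => ∏ i, F i x := fun x y => by
  simp only [← Finset.prod_mul_distrib]
  exact Finset.prod_le_prod (fun i _ => mul_nonneg (F_nonneg i x) (F_nonneg i y))
    fun i _ => hF i x y

lemma of_linearOrder [LinearOrder L] (F : L → ℝ) : LogSupermodular F := fun x y => by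
  rcases le_total x y with h | h
  · simp only [inf_of_le_left h, sup_of_le_right h, le_refl]
  · simp only [inf_of_le_right h, sup_of_le_left h, mul_comm, le_refl]

lemma of_mul_le_mul [LinearOrder L] [LinearOrder M] {K : L → M → ℝ}
    (hK : ∀ ⦃l l'⦄, l ≤ l' → ∀ ⦃m m'⦄, m ≤ m' → K l' m * K l m' ≤ K l m * K l' m') :
    LogSupermodular fun x : L × M => K x.1 x.2 := by
  rintro ⟨l, m⟩ ⟨l', m'⟩
  simp only [Prod.mk_inf_mk, Prod.mk_sup_mk]
  rcases le_total l l' with hl | hl <;> rcases le_total m m' with hm | hm <;>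
    simp only [hl, hm, inf_of_le_left, inf_of_le_right, sup_of_le_left, sup_of_le_right]
  · exact le_rfl
  · exact (mul_comm _ _).trans_le (hK hl hm)
  · exact hK hl hm
  · exact (mul_comm _ _).le

lemma tsum [DistribLattice L] [Lattice M] {F : L × M → ℝ} (hF : LogSupermodular F)
    (F_nonneg : ∀ x, 0 ≤ F x) (summable : ∀ m, Summable fun l => F (l, m)) :
    LogSupermodular fun m => ∑' l, F (l, m) := fun m m' => by
  classical
  refine le_of_tendsto_of_tendsto' ((summable m).hasSum.mul_const _) tendsto_const_nhds fun s => ?_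
  refine le_of_tendsto_of_tendsto' ((summable m').hasSum.const_mul _) tendsto_const_nhds
    fun t => ?_
  have finite_sums := four_functions_theorem (fun l => F (l, m)) (fun l => F (l, m'))
    (fun l => F (l, m ⊓ m')) (fun l => F (l, m ⊔ m')) (fun _ => F_nonneg _) (fun _ => F_nonneg _)
    (fun _ => F_nonneg _) (fun _ => F_nonneg _) (fun l l' => hF (l, m) (l', m')) s t
  exact finite_sums.trans <| mul_le_mul ((summable _).sum_le_tsum _ fun _ _ => F_nonneg _)
    ((summable _).sum_le_tsum _ fun _ _ => F_nonneg _)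
    (Finset.sum_nonneg fun _ _ => F_nonneg _) (tsum_nonneg fun _ => F_nonneg _)

-- Log-supermodularity is applied twice; the two inequalities meet at `q ⊓ p'`.
lemma mul_le_mul_of_codisjoint [DistribLattice L] [OrderTop L] {F : L → ℝ}
    (hF : LogSupermodular F) (F_nonneg : ∀ x, 0 ≤ F x) {p p' q q' : L} (hp : Codisjoint p p')
    (hpq : p ≤ q) (hpq' : p' ≤ q') :
    F (q ⊓ q') * (F p * F p') ≤ F (p ⊓ p') * (F q * F q') := by
  have h₁ : F p * F (q ⊓ p') ≤ F (p ⊓ p') * F q := by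
    simpa only [← inf_assoc, inf_eq_left.2 hpq, sup_inf_left, sup_eq_right.2 hpq, hp.eq_top,
      inf_top_eq] using hF p (q ⊓ p')
  have h₂ : F (q ⊓ q') * F p' ≤ F (q ⊓ p') * F q' := by
    simpa only [inf_assoc, inf_eq_right.2 hpq', sup_inf_right, sup_eq_left.2 hpq',
      (hp.mono_left hpq).eq_top, top_inf_eq] using hF (q ⊓ q') p'
  rcases (F_nonneg (q ⊓ p')).eq_or_lt with h₀ | h₀
  · have : F (q ⊓ q') * F p' ≤ 0 := by simpa only [← h₀, zero_mul] using h₂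
    calc F (q ⊓ q') * (F p * F p') = F p * (F (q ⊓ q') * F p') := by ring
      _ ≤ 0 := mul_nonpos_of_nonneg_of_nonpos (F_nonneg _) this
      _ ≤ F (p ⊓ p') * (F q * F q') :=
        mul_nonneg (F_nonneg _) (mul_nonneg (F_nonneg _) (F_nonneg _))
  · refine le_of_mul_le_mul_right ?_ h₀
    calc F (q ⊓ q') * (F p * F p') * F (q ⊓ p')
        = F p * F (q ⊓ p') * (F (q ⊓ q') * F p') := by ring
      _ ≤ F (p ⊓ p') * F q * (F (q ⊓ p') * F q') :=
        mul_le_mul h₁ h₂ (mul_nonneg (F_nonneg _) (F_nonneg _))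
          (mul_nonneg (F_nonneg _) (F_nonneg _))
      _ = F (p ⊓ p') * (F q * F q') * F (q ⊓ p') := by ring

end LogSupermodular

lemma convexOn_add_le_add {s : Set ℝ} {f : ℝ → ℝ} (hf : ConvexOn ℝ s f) {x u v y : ℝ}
    (hx : x ∈ s) (hy : y ∈ s) (hxu : x ≤ u) (hxv : x ≤ v) (h : u + v = x + y) :
    f u + f v ≤ f x + f y := by
  rcases (show x ≤ y by linarith).eq_or_lt with rfl | hxy
  · rw [show u = x by linarith, show v = x by linarith]
  have hd : 0 < y - x := sub_pos.2 hxy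
  set t := (u - x) / (y - x)
  have ht : t * (y - x) = u - x := div_mul_cancel₀ _ hd.ne'
  have ht₀ : 0 ≤ t := div_nonneg (by linarith) hd.le
  have ht₁ : 0 ≤ 1 - t := sub_nonneg.2 ((div_le_one hd).2 (by linarith))
  have hu : f u ≤ (1 - t) * f x + t * f y := by
    rw [show u = (1 - t) * x + t * y by linarith]
    exact hf.2 hx hy ht₁ ht₀ (by ring)
  have hv : f v ≤ t * f x + (1 - t) * f y := by
    rw [show v = t * x + (1 - t) * y by linarith]
    exact hf.2 hx hy ht₀ ht₁ (by ring)
  linarith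

lemma LogSupermodular.of_convexOn_log {L : Type*} [Lattice L] {s : Set ℝ} {f : ℝ → ℝ}
    (hf : ConvexOn ℝ s (Real.log ∘ f)) (f_pos : ∀ x ∈ s, 0 < f x) {φ : L → ℝ}
    (hφ : ∀ x, φ x ∈ s) (φ_mono : Monotone φ)
    (φ_modular : ∀ x y, φ x + φ y = φ (x ⊓ y) + φ (x ⊔ y)) :
    LogSupermodular fun x => f (φ x) := fun x y => by
  have pos : ∀ z, 0 < f (φ z) := fun z => f_pos _ (hφ z)
  refine (Real.log_le_log_iff (mul_pos (pos _) (pos _)) (mul_pos (pos _) (pos _))).1 ?_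
  rw [Real.log_mul (pos _).ne' (pos _).ne', Real.log_mul (pos _).ne' (pos _).ne']
  exact convexOn_add_le_add hf (hφ _) (hφ _) (φ_mono inf_le_left) (φ_mono inf_le_right)
    (φ_modular x y)

/-! ### Gamma laws -/

lemma ennreal_tsum_pi_prod {ι : Type*} [Fintype ι] {X : ι → Type*} (f : ∀ i, X i → ℝ≥0∞) :
    ∑' N : ∀ i, X i, ∏ i, f i (N i) = ∏ i, ∑' m, f i m := by
  revert X
  refine Fintype.induction_empty_option (P := fun ι _ => ∀ {X : ι → Type _} (f : ∀ i, X i → ℝ≥0∞),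
    ∑' N : ∀ i, X i, ∏ i, f i (N i) = ∏ i, ∑' m, f i m) ?_ ?_ ?_ ι
  · intro ι κ _ e ih X f
    let _ := Fintype.ofEquiv κ e.symm
    rw [← e.prod_comp, ← ih fun i => f (e i), ← (e.piCongrLeft X).tsum_eq]
    refine tsum_congr fun N => ?_
    rw [← e.prod_comp]
    simp only [Equiv.piCongrLeft_apply_apply]
  · intro X f
    simp
  · intro ι _ ih X f
    rw [Fintype.prod_option, ← ih fun i => f (some i), ← Equiv.piOptionEquivProd.symm.tsum_eq,
      ENNReal.tsum_prod', ← ENNReal.tsum_mul_right]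
    refine tsum_congr fun m => ?_
    rw [← ENNReal.tsum_mul_left]
    exact tsum_congr fun N => Fintype.prod_option _

lemma lintegral_pi_prod {ι : Type*} [Fintype ι] {X : ι → Type*} [∀ i, MeasurableSpace (X i)]
    (μ : ∀ i, Measure (X i)) [∀ i, IsProbabilityMeasure (μ i)] (f : ∀ i, X i → ℝ≥0∞)
    (hf : ∀ i, Measurable (f i)) :
    ∫⁻ x, ∏ i, f i (x i) ∂Measure.pi μ = ∏ i, ∫⁻ x, f i x ∂μ i := by
  rw [lintegral_prod_eq_prod_lintegral_of_indepFun _ _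
    (iIndepFun_pi fun i => (hf i).aemeasurable) fun i => (hf i).comp (measurable_pi_apply i)]
  exact Finset.prod_congr rfl fun i _ => (measurePreserving_eval μ i).lintegral_comp (hf i)

lemma tsum_ofReal_pow_div_factorial {x : ℝ} (hx : 0 ≤ x) :
    ∑' m : ℕ, ENNReal.ofReal (x ^ m / m.factorial) = ENNReal.ofReal (Real.exp x) := by
  have h := NormedSpace.expSeries_div_hasSum_exp (𝔸 := ℝ) x
  rw [← ENNReal.ofReal_tsum_of_nonneg (fun m => by positivity) h.summable, h.tsum_eq,
    Real.exp_eq_exp_ℝ]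

lemma measurable_gammaPDF (a r : ℝ) : Measurable (gammaPDF a r) :=
  (measurable_gammaPDFReal a r).ennreal_ofReal

lemma ae_pos_gammaMeasure (a r : ℝ) : ∀ᵐ x ∂gammaMeasure a r, 0 < x := by
  rw [gammaMeasure, ae_withDensity_iff (measurable_gammaPDF a r)]
  filter_upwards [Measure.ae_ne volume (0 : ℝ)] with x hx₀ hx
  by_contra h
  exact hx (gammaPDF_of_neg (lt_of_le_of_ne (not_lt.1 h) hx₀))

lemma lintegral_gammaMeasure_of_gammaPDFReal_mul {a r a' r' k : ℝ} (ha : 0 < a) (hr : 0 < r)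
    (ha' : 0 < a') (hr' : 0 < r') {f : ℝ → ℝ} (hf : Measurable f) (hk : 0 ≤ k)
    (h : ∀ x, 0 < x → gammaPDFReal a r x * f x = k * gammaPDFReal a' r' x) :
    ∫⁻ x, ENNReal.ofReal (f x) ∂gammaMeasure a r = ENNReal.ofReal k := by
  rw [gammaMeasure, lintegral_withDensity_eq_lintegral_mul _ (measurable_gammaPDF a r)
    hf.ennreal_ofReal, ← mul_one (ENNReal.ofReal k), ← lintegral_gammaPDF_eq_one ha' hr',
    ← lintegral_const_mul _ (measurable_gammaPDF a' r')]
  refine lintegral_congr_ae ?_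
  filter_upwards [Measure.ae_ne volume (0 : ℝ)] with x hx
  rcases hx.lt_or_gt with hx | hx
  · simp only [Pi.mul_apply, gammaPDF_of_neg hx, zero_mul, mul_zero]
  · simp only [Pi.mul_apply, gammaPDF, ← ENNReal.ofReal_mul hk, ← h x hx,
      ENNReal.ofReal_mul (gammaPDFReal_nonneg ha hr x)]

lemma lintegral_exp_neg_mul_gammaMeasure {a r t : ℝ} (ha : 0 < a) (hr : 0 < r) (ht : 0 < r + t) :
    ∫⁻ x, ENNReal.ofReal (Real.exp (-(t * x))) ∂gammaMeasure a r =
      ENNReal.ofReal ((r / (r + t)) ^ a) := by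
  refine lintegral_gammaMeasure_of_gammaPDFReal_mul ha hr ha ht (by fun_prop) (by positivity)
    fun x hx => ?_
  have hexp : Real.exp (-((r + t) * x)) = Real.exp (-(r * x)) * Real.exp (-(t * x)) := by
    rw [← Real.exp_add]; ring_nf
  simp only [gammaPDFReal, if_pos hx.le, hexp, Real.div_rpow hr.le ht.le]
  field_simp

lemma lintegral_pow_gammaMeasure {a r : ℝ} (ha : 0 < a) (hr : 0 < r) (m : ℕ) :
    ∫⁻ x, ENNReal.ofReal (x ^ m) ∂gammaMeasure a r =
      ENNReal.ofReal (Real.Gamma (a + m) / (Real.Gamma a * r ^ m)) := by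
  have ham : 0 < a + m := by positivity
  have := Real.Gamma_pos_of_pos ha
  have := Real.Gamma_pos_of_pos ham
  refine lintegral_gammaMeasure_of_gammaPDFReal_mul ha hr ham hr (by fun_prop) (by positivity)
    fun x hx => ?_
  have hpow : x ^ (a + m - 1) = x ^ (a - 1) * x ^ m := by
    rw [← Real.rpow_natCast, ← Real.rpow_add hx]; ring_nf
  simp only [gammaPDFReal, if_pos hx.le, hpow, Real.rpow_add hr, Real.rpow_natCast]
  field_simp

lemma withDensity_mul_withDensity_le {Ω : Type*} [MeasurableSpace Ω] {ν : Measure Ω}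
    {f g : Ω → ℝ≥0∞} (hf : Measurable f) (hg : Measurable g) {S T : Set Ω} (hS : MeasurableSet S)
    (hT : MeasurableSet T) (hST : S ⊆ T)
    (hfg : ∀ᵐ u ∂ν, u ∈ S → ∀ v ∈ T \ S, g u * f v ≤ f u * g v) :
    ν.withDensity g S * ν.withDensity f T ≤ ν.withDensity f S * ν.withDensity g T := by
  have hD : MeasurableSet (T \ S) := hT.diff hS
  have split : ∀ h : Ω → ℝ≥0∞,
      ν.withDensity h T = ν.withDensity h S + ν.withDensity h (T \ S) := fun h => by
    rw [← measure_union Set.disjoint_sdiff_right hD, Set.union_sdiff_cancel hST]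
  have hdouble : ∀ {h k : Ω → ℝ≥0∞}, Measurable h → Measurable k →
      ν.withDensity h S * ν.withDensity k (T \ S) =
        ∫⁻ u in S, ∫⁻ v in T \ S, h u * k v ∂ν ∂ν := fun {h k} hh hk => by
    rw [withDensity_apply _ hS, withDensity_apply _ hD, ← lintegral_mul_const _ hh]
    simp_rw [lintegral_const_mul _ hk]
  -- The products of masses of `S` cancel, leaving the masses of `S` and of its complement
  -- in `T`, where `hfg` applies pointwise.
  rw [split f, split g, mul_add, mul_add, mul_comm (ν.withDensity g S) (ν.withDensity f S)]
  gcongr 1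
  rw [hdouble hg hf, hdouble hf hg]
  refine setLIntegral_mono_ae' hS ?_
  filter_upwards [hfg] with u hu huS using setLIntegral_mono' hD (hu huS)

lemma gammaPDFReal_mul_gammaPDFReal_le {a a' r : ℝ} (ha : 0 < a) (haa' : a ≤ a') (hr : 0 < r)
    {u v : ℝ} (hu : 0 < u) (huv : u ≤ v) :
    gammaPDFReal a' r u * gammaPDFReal a r v ≤ gammaPDFReal a r u * gammaPDFReal a' r v := by
  have hv := hu.trans_le huv
  have split : ∀ x : ℝ, 0 < x → x ^ (a' - 1) = x ^ (a - 1) * x ^ (a' - a) := fun x hx => by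
    rw [← Real.rpow_add hx]; ring_nf
  have := Real.Gamma_pos_of_pos ha
  have := Real.Gamma_pos_of_pos (ha.trans_le haa')
  simp only [gammaPDFReal, if_pos hu.le, if_pos hv.le, split u hu, split v hv]
  set k := r ^ a' / Real.Gamma a' * (r ^ a / Real.Gamma a) * u ^ (a - 1) * v ^ (a - 1) *
    Real.exp (-(r * u)) * Real.exp (-(r * v))
  calc _ = k * u ^ (a' - a) := by ring
    _ ≤ k * v ^ (a' - a) := by gcongr
    _ = _ := by ring

lemma measurableSet_lowerSet (S : LowerSet ℝ) : MeasurableSet (S : Set ℝ) :=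
  S.lower.ordConnected.measurableSet

lemma gammaMeasure_mul_gammaMeasure_le {a a' r : ℝ} (ha : 0 < a) (haa' : a ≤ a') (hr : 0 < r)
    {S T : LowerSet ℝ} (hST : S ≤ T) :
    gammaMeasure a' r S * gammaMeasure a r T ≤ gammaMeasure a r S * gammaMeasure a' r T := by
  refine withDensity_mul_withDensity_le (measurable_gammaPDF a r)
    (measurable_gammaPDF a' r) (measurableSet_lowerSet S)
    (measurableSet_lowerSet T) hST ?_
  filter_upwards [Measure.ae_ne volume (0 : ℝ)] with u hu₀ hu v hv
  have huv : u ≤ v := le_of_not_ge fun hvu => hv.2 (S.lower hvu hu)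
  rcases hu₀.lt_or_gt with hneg | hpos
  · simp only [gammaPDF_of_neg hneg, zero_mul, le_refl]
  have ha' := ha.trans_le haa'
  simp only [gammaPDF, ← ENNReal.ofReal_mul (gammaPDFReal_nonneg ha hr u),
    ← ENNReal.ofReal_mul (gammaPDFReal_nonneg ha' hr u)]
  exact ENNReal.ofReal_le_ofReal (gammaPDFReal_mul_gammaPDFReal_le ha haa' hr hpos huv)

lemma logSupermodular_gammaMeasure {α r : ℝ} (hα : 0 < α) (hr : 0 < r) :
    LogSupermodular fun x : ℕ × LowerSet ℝ => (gammaMeasure (α + x.1) r).real x.2 := by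
  refine .of_mul_le_mul (K := fun (m : ℕ) (S : LowerSet ℝ) => (gammaMeasure (α + m) r).real S)
    fun m m' hm S T hST => ?_
  have := isProbabilityMeasure_gammaMeasure (show 0 < α + m by positivity) hr
  have := isProbabilityMeasure_gammaMeasure (show 0 < α + m' by positivity) hr
  simp only [measureReal_def, ← ENNReal.toReal_mul]
  exact ENNReal.toReal_mono (by finiteness)
    (gammaMeasure_mul_gammaMeasure_le (by positivity) (by gcongr) hr hST)

lemma gammaMeasure_Iic_pos {a r x : ℝ} (ha : 0 < a) (hr : 0 < r) (hx : 0 < x) :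
    0 < gammaMeasure a r (Set.Iic x) := by
  refine (measure_mono fun u (hu : u ∈ Set.Ioo 0 x) => hu.2.le).trans_lt' ?_
  rw [gammaMeasure, withDensity_apply _ measurableSet_Ioo,
    setLIntegral_pos_iff (measurable_gammaPDF a r)]
  have support_eq : Function.support (gammaPDF a r) ∩ Set.Ioo 0 x = Set.Ioo 0 x :=
    Set.inter_eq_right.2 fun u hu => (ENNReal.ofReal_pos.2 (gammaPDFReal_pos ha hr hu.1)).ne'
  rw [support_eq, Real.volume_Ioo, ENNReal.ofReal_pos]
  linarith

/-! ### The mixture weights -/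

/-- The sums of a family over the blocks `c i = b` of its index set. -/
def blockSum {ι κ M : Type*} [Fintype ι] [DecidableEq κ] [AddCommMonoid M] (c : ι → κ) (x : ι → M)
    (b : κ) : M :=
  ∑ i with c i = b, x i

section BlockSum

variable {ι κ R : Type*} [Fintype ι] [Fintype κ] [DecidableEq κ] (c : ι → κ)

lemma prod_pow_blockSum [CommMonoid R] (t : κ → R) (N : ι → ℕ) :
    ∏ b, t b ^ blockSum c N b = ∏ i, t (c i) ^ N i := by
  simp only [blockSum, ← Finset.prod_pow_eq_pow_sum]
  rw [← Finset.prod_fiberwise Finset.univ c]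
  refine Finset.prod_congr rfl fun b _ => Finset.prod_congr rfl fun i hi => ?_
  rw [(Finset.mem_filter.1 hi).2]

lemma sum_mul_blockSum [NonUnitalNonAssocSemiring R] (t : κ → R) (x : ι → R) :
    ∑ b, t b * blockSum c x b = ∑ i, t (c i) * x i := by
  simp only [blockSum, Finset.mul_sum]
  rw [← Finset.sum_fiberwise Finset.univ c]
  refine Finset.sum_congr rfl fun b _ => Finset.sum_congr rfl fun i hi => ?_
  rw [(Finset.mem_filter.1 hi).2]

end BlockSum

lemma ae_pos_pi_gammaMeasure {ι : Type*} [Fintype ι] {a r : ι → ℝ} (ha : ∀ i, 0 < a i)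
    (hr : ∀ i, 0 < r i) : ∀ᵐ x ∂Measure.pi fun i => gammaMeasure (a i) (r i), ∀ i, 0 < x i := by
  have := fun i => isProbabilityMeasure_gammaMeasure (ha i) (hr i)
  exact ae_all_iff.2 fun i =>
    (Measure.quasiMeasurePreserving_eval _ i).ae (ae_pos_gammaMeasure (a i) (r i))

section NegativeMultinomial

variable {ι κ : Type*} [Fintype ι] [Fintype κ] [DecidableEq κ] (c : ι → κ) {β : ℝ} {r : ι → ℝ}

lemma ofReal_prod_Gamma_add_blockSum (hβ : 0 < β) (hr : ∀ i, 0 ≤ r i) (N : ι → ℕ) :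
    ENNReal.ofReal ((∏ b, Real.Gamma (β + blockSum c N b)) * ∏ i, r i ^ N i / (N i).factorial) =
      ENNReal.ofReal (∏ _b : κ, Real.Gamma β) *
        ∫⁻ x, ∏ i, ENNReal.ofReal ((x (c i) * r i) ^ N i / (N i).factorial)
          ∂Measure.pi fun _ => gammaMeasure β 1 := by
  have := isProbabilityMeasure_gammaMeasure hβ one_pos
  have Γ_pos : ∀ m : ℕ, 0 < Real.Gamma (β + m) := fun m => Real.Gamma_pos_of_pos (by positivity)
  have Γβ_pos := Real.Gamma_pos_of_pos hβ
  have coeff_nonneg : 0 ≤ ∏ i, r i ^ N i / (N i).factorial :=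
    Finset.prod_nonneg fun i _ => div_nonneg (pow_nonneg (hr i) _) (Nat.cast_nonneg _)
  have integrand : ∀ᵐ x ∂Measure.pi fun _ : κ => gammaMeasure β 1,
      ∏ i, ENNReal.ofReal ((x (c i) * r i) ^ N i / (N i).factorial) =
        (∏ b, ENNReal.ofReal (x b ^ blockSum c N b)) *
          ENNReal.ofReal (∏ i, r i ^ N i / (N i).factorial) := by
    filter_upwards [ae_pos_pi_gammaMeasure (fun _ : κ => hβ) fun _ => one_pos] with x hx
    rw [← ENNReal.ofReal_prod_of_nonneg fun b _ => pow_nonneg (hx b).le _,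
      ← ENNReal.ofReal_prod_of_nonneg fun i _ =>
        div_nonneg (pow_nonneg (mul_nonneg (hx _).le (hr i)) _) (Nat.cast_nonneg _),
      ← ENNReal.ofReal_mul (Finset.prod_nonneg fun b _ => pow_nonneg (hx b).le _),
      prod_pow_blockSum, ← Finset.prod_mul_distrib]
    simp only [mul_pow, mul_div_assoc]
  rw [lintegral_congr_ae integrand, lintegral_mul_const' _ _ ENNReal.ofReal_ne_top,
    lintegral_pi_prod _ (fun b x => ENNReal.ofReal (x ^ blockSum c N b)) (fun b => by fun_prop),
    ← mul_assoc,
    ENNReal.ofReal_prod_of_nonneg fun _ _ => Γβ_pos.le, ← Finset.prod_mul_distrib,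
    ENNReal.ofReal_mul' coeff_nonneg, ENNReal.ofReal_prod_of_nonneg fun b _ => (Γ_pos _).le]
  congr 1
  refine Finset.prod_congr rfl fun b _ => ?_
  rw [lintegral_pow_gammaMeasure hβ one_pos, ← ENNReal.ofReal_mul Γβ_pos.le, one_pow, mul_one,
    mul_div_cancel₀ _ Γβ_pos.ne']

lemma tsum_prod_Gamma_add_blockSum (hβ : 0 < β) (hr : ∀ i, 0 ≤ r i)
    (hr₁ : ∀ b, blockSum c r b < 1) :
    ∑' N : ι → ℕ, ENNReal.ofReal
        ((∏ b, Real.Gamma (β + blockSum c N b)) * ∏ i, r i ^ N i / (N i).factorial) =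
      ENNReal.ofReal (∏ b, (1 - blockSum c r b) ^ (-β) * Real.Gamma β) := by
  have := isProbabilityMeasure_gammaMeasure hβ one_pos
  have Γβ_pos := Real.Gamma_pos_of_pos hβ
  -- Since `Γ(β + m) / Γ(β)` is the `m`-th moment of a gamma law, the sum is the Laplace transform
  -- of a product of gamma laws, expanded into an exponential series under the integral.
  have exp_series : ∀ᵐ x ∂Measure.pi fun _ : κ => gammaMeasure β 1,
      ∑' N : ι → ℕ, ∏ i, ENNReal.ofReal ((x (c i) * r i) ^ N i / (N i).factorial) =
        ∏ b, ENNReal.ofReal (Real.exp (-(-blockSum c r b * x b))) := by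
    filter_upwards [ae_pos_pi_gammaMeasure (fun _ : κ => hβ) fun _ => one_pos] with x hx
    rw [ennreal_tsum_pi_prod fun i (m : ℕ) => ENNReal.ofReal ((x (c i) * r i) ^ m / m.factorial)]
    simp only [tsum_ofReal_pow_div_factorial (mul_nonneg (hx _).le (hr _)), mul_comm _ (x _),
      mul_neg, neg_neg, ← ENNReal.ofReal_prod_of_nonneg fun _ _ => (Real.exp_pos _).le,
      ← Real.exp_sum]
    rw [sum_mul_blockSum]
  simp only [ofReal_prod_Gamma_add_blockSum c hβ hr]
  rw [ENNReal.tsum_mul_left, ← lintegral_tsum fun N => Measurable.aemeasurable (by fun_prop),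
    lintegral_congr_ae exp_series, lintegral_pi_prod _
      (fun b x => ENNReal.ofReal (Real.exp (-(-blockSum c r b * x)))) (fun b => by fun_prop),
    ENNReal.ofReal_prod_of_nonneg fun _ _ => Γβ_pos.le,
    ← Finset.prod_mul_distrib, ENNReal.ofReal_prod_of_nonneg fun b _ =>
      mul_nonneg (Real.rpow_nonneg (sub_pos.2 (hr₁ b)).le _) Γβ_pos.le]
  refine Finset.prod_congr rfl fun b _ => ?_
  have hb : 0 < 1 + -blockSum c r b := by linarith [hr₁ b]
  rw [lintegral_exp_neg_mul_gammaMeasure hβ one_pos hb, mul_comm,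
    ← ENNReal.ofReal_mul (by positivity), one_div, Real.inv_rpow hb.le, ← Real.rpow_neg hb.le,
    sub_eq_add_neg]

lemma tsum_Gamma_add_mul_pow_div_factorial {x : ℝ} (hβ : 0 < β) (hx : 0 ≤ x) (hx₁ : x < 1) :
    ∑' m : ℕ, ENNReal.ofReal (Real.Gamma (β + m) * (x ^ m / m.factorial)) =
      ENNReal.ofReal ((1 - x) ^ (-β) * Real.Gamma β) := by
  have h := tsum_prod_Gamma_add_blockSum (ι := Unit) (κ := Unit) (r := fun _ => x) id hβ
    (fun _ => hx) (fun _ => by simpa [blockSum] using hx₁)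
  rw [← (Equiv.funUnique Unit ℕ).symm.tsum_eq] at h
  simpa [blockSum] using h

end NegativeMultinomial

/-- The weights of the mixture of products of gamma laws that represents a multivariate gamma law
with two blocks `c i = 0` and `c i = 1`, up to the normalizing constant. The index `k` is shared by
all coordinates, and `N i` is the shift of the shape parameter of the `i`-th coordinate. -/
noncomputable def mixWeight {ι : Type*} [Fintype ι] (c : ι → Fin 2) (α θ : ℝ) (p : ι → ℝ)
    (u : ℕ × (ι → ℕ)) : ℝ :=
  θ ^ u.1 / (u.1.factorial * Real.Gamma (α + u.1)) *
    (∏ b, Real.Gamma (α + (u.1 + blockSum c u.2 b : ℕ))) * ∏ i, p i ^ u.2 i / (u.2 i).factorial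

section MixWeight

variable {ι : Type*} [Fintype ι] (c : ι → Fin 2) {α θ : ℝ} {p : ι → ℝ}

lemma mixWeight_nonneg (hα : 0 < α) (hθ : 0 ≤ θ) (hp : ∀ i, 0 ≤ p i) (u : ℕ × (ι → ℕ)) :
    0 ≤ mixWeight c α θ p u := by
  have Γ_nonneg : ∀ m : ℕ, 0 ≤ Real.Gamma (α + m) := fun m =>
    Real.Gamma_nonneg_of_nonneg (by positivity)
  exact mul_nonneg (mul_nonneg
    (div_nonneg (pow_nonneg hθ _) (mul_nonneg (Nat.cast_nonneg _) (Γ_nonneg _)))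
    (Finset.prod_nonneg fun b _ => Γ_nonneg _))
    (Finset.prod_nonneg fun i _ => div_nonneg (pow_nonneg (hp i) _) (Nat.cast_nonneg _))

lemma mixWeight_zero_pos (hα : 0 < α) : 0 < mixWeight c α θ p 0 := by
  have := Real.Gamma_pos_of_pos hα
  simp only [mixWeight, blockSum, Prod.fst_zero, Prod.snd_zero, Pi.zero_apply, pow_zero,
    Finset.sum_const_zero, Nat.factorial_zero, Nat.cast_one, Nat.cast_zero, add_zero]
  positivity

lemma logSupermodular_mixWeight (hα : 0 < α) (hθ : 0 ≤ θ) (hp : ∀ i, 0 ≤ p i) :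
    LogSupermodular (mixWeight c α θ p) := by
  have Γ_nonneg : ∀ m : ℕ, 0 ≤ Real.Gamma (α + m) := fun m =>
    Real.Gamma_nonneg_of_nonneg (by positivity)
  have power_nonneg : ∀ i (m : ℕ), 0 ≤ p i ^ m / m.factorial := fun i m =>
    div_nonneg (pow_nonneg (hp i) _) (Nat.cast_nonneg _)
  have series_nonneg : ∀ k : ℕ, 0 ≤ θ ^ k / (k.factorial * Real.Gamma (α + k)) := fun k =>
    div_nonneg (pow_nonneg hθ _) (mul_nonneg (Nat.cast_nonneg _) (Γ_nonneg _))
  have shared : LogSupermodular fun u : ℕ × (ι → ℕ) =>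
      θ ^ u.1 / (u.1.factorial * Real.Gamma (α + u.1)) :=
    (LogSupermodular.of_linearOrder fun k : ℕ => θ ^ k / (k.factorial * Real.Gamma (α + k))).comp
      (fun _ _ => rfl) fun _ _ => rfl
  have power : ∀ i, LogSupermodular fun u : ℕ × (ι → ℕ) => p i ^ u.2 i / (u.2 i).factorial :=
    fun i => (LogSupermodular.of_linearOrder fun m : ℕ => p i ^ m / m.factorial).comp
      (g := fun u : ℕ × (ι → ℕ) => u.2 i) (fun _ _ => rfl) fun _ _ => rfl
  have gamma : ∀ b, LogSupermodular fun u : ℕ × (ι → ℕ) =>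
      Real.Gamma (α + (u.1 + blockSum c u.2 b : ℕ)) := fun b => by
    refine .of_convexOn_log Real.convexOn_log_Gamma (fun _ => Real.Gamma_pos_of_pos)
      (fun u => Set.mem_Ioi.2 (by positivity)) (fun u v huv => ?_) fun u v => ?_
    · have hsum : blockSum c u.2 b ≤ blockSum c v.2 b := Finset.sum_le_sum fun i _ => huv.2 i
      have hfst : u.1 ≤ v.1 := huv.1
      gcongr
    · have hsum : blockSum c u.2 b + blockSum c v.2 b =
          blockSum c (u ⊓ v).2 b + blockSum c (u ⊔ v).2 b := by
        simp only [blockSum, ← Finset.sum_add_distrib]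
        exact Finset.sum_congr rfl fun i _ => (min_add_max (u.2 i) (v.2 i)).symm
      have hfst : u.1 + v.1 = (u ⊓ v).1 + (u ⊔ v).1 := (min_add_max u.1 v.1).symm
      have := congrArg (Nat.cast (R := ℝ)) hsum
      have := congrArg (Nat.cast (R := ℝ)) hfst
      push_cast at *
      linarith
  exact (shared.mul (.prod gamma fun _ _ => Γ_nonneg _) (fun _ => series_nonneg _)
    fun _ => Finset.prod_nonneg fun _ _ => Γ_nonneg _).mul (.prod power fun _ _ => power_nonneg _ _)
    (fun _ => mul_nonneg (series_nonneg _) (Finset.prod_nonneg fun _ _ => Γ_nonneg _))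
    fun _ => Finset.prod_nonneg fun _ _ => power_nonneg _ _

lemma tsum_mixWeight_mul_prod_pow (hα : 0 < α) (hθ : 0 ≤ θ) (hp : ∀ i, 0 ≤ p i) {z : ι → ℝ}
    (hz : ∀ i, 0 ≤ z i) (hpz : ∀ b, blockSum c (p * z) b < 1)
    (hθ_lt : θ < ∏ b, (1 - blockSum c (p * z) b)) :
    ∑' u, ENNReal.ofReal (mixWeight c α θ p u * ∏ i, z i ^ u.2 i) =
      ENNReal.ofReal (Real.Gamma α * (∏ b, (1 - blockSum c (p * z) b) - θ) ^ (-α)) := by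
  set A := ∏ b, (1 - blockSum c (p * z) b) with hA
  have A_pos : 0 < A := Finset.prod_pos fun b _ => sub_pos.2 (hpz b)
  have inner : ∀ k : ℕ, ∑' N, ENNReal.ofReal (mixWeight c α θ p (k, N) * ∏ i, z i ^ N i) =
      ENNReal.ofReal (A ^ (-α)) *
        ENNReal.ofReal (Real.Gamma (α + k) * ((θ / A) ^ k / k.factorial)) := fun k => by
    have hαk : 0 < α + k := by positivity
    have := Real.Gamma_pos_of_pos hαk
    have regroup : ∀ N, mixWeight c α θ p (k, N) * ∏ i, z i ^ N i =
        θ ^ k / (k.factorial * Real.Gamma (α + k)) *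
          ((∏ b, Real.Gamma (α + k + blockSum c N b)) *
            ∏ i, (p * z) i ^ N i / (N i).factorial) := fun N => by
      simp only [mixWeight, Nat.cast_add, ← add_assoc, mul_assoc, ← Finset.prod_mul_distrib,
        Pi.mul_apply, mul_pow, mul_div_right_comm]
    have hA_rpow : ∏ b, (1 - blockSum c (p * z) b) ^ (-(α + k)) * Real.Gamma (α + k) =
        A ^ (-α) / A ^ k * Real.Gamma (α + k) ^ 2 := by
      rw [Finset.prod_mul_distrib, Real.finsetProd_rpow _ _ fun b _ => (sub_pos.2 (hpz b)).le,
        ← hA, neg_add, Real.rpow_add A_pos, Real.rpow_neg A_pos.le k, Real.rpow_natCast,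
        Finset.prod_const, Finset.card_univ, Fintype.card_fin, div_eq_mul_inv]
    simp only [regroup, ENNReal.ofReal_mul (p := θ ^ k / (k.factorial * Real.Gamma (α + k)))
      (by positivity)]
    rw [ENNReal.tsum_mul_left, tsum_prod_Gamma_add_blockSum c (r := p * z) hαk
      (fun i => mul_nonneg (hp i) (hz i)) hpz, hA_rpow, ← ENNReal.ofReal_mul (by positivity),
      ← ENNReal.ofReal_mul (by positivity), div_pow]
    congr 1
    field_simp
  simp only [ENNReal.tsum_prod', inner]
  rw [ENNReal.tsum_mul_left, tsum_Gamma_add_mul_pow_div_factorial hα (by positivity)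
    ((div_lt_one A_pos).2 hθ_lt), ← ENNReal.ofReal_mul (by positivity), ← mul_assoc,
    ← Real.mul_rpow A_pos.le (sub_nonneg.2 ((div_le_one A_pos).2 hθ_lt.le)), mul_sub, mul_one,
    mul_div_cancel₀ _ A_pos.ne', mul_comm]

end MixWeight

/-! ### Mixtures of product measures -/

/-- The probability that every coordinate lies in a prescribed lower set. This covers the joint
distribution function and, with the full line as one of the lower sets, its marginals. -/
noncomputable def boxMass {ι : Type*} (μ : Measure (ι → ℝ)) (S : ι → LowerSet ℝ) : ℝ :=
  μ.real {x | ∀ i, x i ∈ S i}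

/-- The mixture, with weights `w u`, of the product measures with factors `ν u i`. -/
noncomputable def productMixture {L ι : Type*} [Fintype ι] (w : L → ℝ) (ν : L → ι → Measure ℝ) :
    Measure (ι → ℝ) :=
  Measure.sum fun u => ENNReal.ofReal (w u) • Measure.pi (ν u)

section ProductMixture

variable {L ι : Type*} [Fintype ι] {w : L → ℝ} {ν : L → ι → Measure ℝ}

lemma ae_productMixture [Countable L] {P : (ι → ℝ) → Prop}
    (h : ∀ u, ∀ᵐ x ∂Measure.pi (ν u), P x) : ∀ᵐ x ∂productMixture w ν, P x :=
  Measure.ae_sum_iff.2 fun u => Measure.ae_smul_measure (h u) _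

variable [∀ u i, IsProbabilityMeasure (ν u i)]

lemma lintegral_prod_productMixture (f : ι → ℝ → ℝ≥0∞) (hf : ∀ i, Measurable (f i)) :
    ∫⁻ x, ∏ i, f i (x i) ∂productMixture w ν =
      ∑' u, ENNReal.ofReal (w u) * ∏ i, ∫⁻ x, f i x ∂ν u i := by
  simp only [productMixture, lintegral_sum_measure, lintegral_smul_measure, smul_eq_mul,
    lintegral_pi_prod _ f hf]

variable [IsFiniteMeasure (productMixture w ν)]

lemma hasSum_boxMass_productMixture (w_nonneg : ∀ u, 0 ≤ w u) (S : ι → LowerSet ℝ) :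
    HasSum (fun u => w u * ∏ i, (ν u i).real (S i)) (boxMass (productMixture w ν) S) := by
  have hS : MeasurableSet (Set.univ.pi fun i => (S i : Set ℝ)) :=
    .univ_pi fun i => measurableSet_lowerSet (S i)
  have box_eq : {x : ι → ℝ | ∀ i, x i ∈ S i} = Set.univ.pi fun i => (S i : Set ℝ) := by
    ext x; simp
  have mass : productMixture w ν {x | ∀ i, x i ∈ S i} =
      ∑' u, ENNReal.ofReal (w u) * ∏ i, ν u i (S i) := by
    simp only [box_eq, productMixture, Measure.sum_apply _ hS, Measure.smul_apply,
      Measure.pi_pi, smul_eq_mul]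
  have finite : ∑' u, ENNReal.ofReal (w u) * ∏ i, ν u i (S i) ≠ ∞ := mass ▸ measure_ne_top _ _
  rw [boxMass, measureReal_def, mass, ENNReal.tsum_toReal_eq (ENNReal.ne_top_of_tsum_ne_top finite)]
  simpa only [measureReal_def, ENNReal.toReal_mul, ENNReal.toReal_ofReal (w_nonneg _),
    ENNReal.toReal_prod] using ENNReal.hasSum_toReal finite

lemma boxMass_productMixture_pos (w_nonneg : ∀ u, 0 ≤ w u) {u : L} (hu : 0 < w u)
    {S : ι → LowerSet ℝ} (hS : ∀ i, 0 < ν u i (S i)) : 0 < boxMass (productMixture w ν) S :=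
  have factor_pos : ∀ i, 0 < (ν u i).real (S i) := fun i =>
    ENNReal.toReal_pos (hS i).ne' (measure_ne_top _ _)
  (mul_pos hu (Finset.prod_pos fun i _ => factor_pos i)).trans_le
    (le_hasSum (hasSum_boxMass_productMixture w_nonneg S) u fun v _ =>
      mul_nonneg (w_nonneg v) (Finset.prod_nonneg fun _ _ => measureReal_nonneg))

lemma logSupermodular_boxMass_productMixture [DistribLattice L] (hw : LogSupermodular w)
    (w_nonneg : ∀ u, 0 ≤ w u)
    (hν : ∀ i, LogSupermodular fun x : L × LowerSet ℝ => (ν x.1 i).real x.2) :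
    LogSupermodular (boxMass (productMixture w ν)) := by
  have hasSum := hasSum_boxMass_productMixture (ν := ν) w_nonneg
  have factor : ∀ i, LogSupermodular fun x : L × (ι → LowerSet ℝ) => (ν x.1 i).real (x.2 i) :=
    fun i => (hν i).comp (g := fun x : L × (ι → LowerSet ℝ) => (x.1, x.2 i)) (fun _ _ => rfl)
      fun _ _ => rfl
  have prod_nonneg : ∀ x : L × (ι → LowerSet ℝ), 0 ≤ ∏ i, (ν x.1 i).real (x.2 i) := fun _ =>
    Finset.prod_nonneg fun _ _ => measureReal_nonneg
  have term : LogSupermodular fun x : L × (ι → LowerSet ℝ) => w x.1 * ∏ i, (ν x.1 i).real (x.2 i) :=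
    (hw.comp (fun _ _ => rfl) fun _ _ => rfl).mul (.prod factor fun _ _ => measureReal_nonneg)
      (fun _ => w_nonneg _) prod_nonneg
  simpa only [(hasSum _).tsum_eq] using
    term.tsum (fun x => mul_nonneg (w_nonneg _) (prod_nonneg x)) fun S => (hasSum S).summable

end ProductMixture

/-! ### Block correlation matrices -/

/-- The matrix with diagonal entries `1` and off-diagonal entries `a i * a j` inside the blocks
`c i = b` and `ϑ * a i * a j` between them. -/
def blockCorr {ι κ K : Type*} [DecidableEq ι] [DecidableEq κ] [Ring K] (c : ι → κ) (a : ι → K)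
    (ϑ : K) : Matrix ι ι K :=
  Matrix.diagonal (fun i => 1 - a i ^ 2) +
    Matrix.of fun i j => (if c i = c j then 1 else ϑ) * (a i * a j)

section Determinant

variable {ι κ K : Type*} [Fintype ι] [DecidableEq ι] [Fintype κ] [DecidableEq κ] [Field K]
  (c : ι → κ) (a : ι → K) (ϑ : K) {t : ι → K}

lemma det_one_add_blockCorr_mul_diagonal (ht : ∀ i, 1 + (1 - a i ^ 2) * t i ≠ 0) :
    (1 + blockCorr c a ϑ * Matrix.diagonal t).det =
      (∏ i, (1 + (1 - a i ^ 2) * t i)) *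
        (1 + Matrix.of fun b b' => (if b = b' then 1 else ϑ) *
          blockSum c (fun i => a i ^ 2 * t i / (1 + (1 - a i ^ 2) * t i)) b).det := by
  -- Up to a diagonal matrix this has rank at most `|κ|`, and the Weinstein–Aronszajn identity
  -- leaves a determinant over `κ`.
  set e : ι → K := fun i => 1 + (1 - a i ^ 2) * t i with he
  let U : Matrix ι κ K := Matrix.of fun i b => (if c i = b then 1 else ϑ) * (a i / e i)
  let V : Matrix κ ι K := Matrix.of fun b j => if c j = b then a j * t j else 0
  have factorization : 1 + blockCorr c a ϑ * Matrix.diagonal t =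
      Matrix.diagonal e * (1 + U * V) := by
    ext i j
    have hUV : (U * V) i j = (if c i = c j then 1 else ϑ) * (a i / e i) * (a j * t j) := by
      simp [U, V, Matrix.mul_apply]
    rw [Matrix.mul_add, mul_one, Matrix.add_apply, Matrix.add_apply, Matrix.diagonal_mul,
      Matrix.mul_diagonal, hUV, blockCorr, Matrix.add_apply, Matrix.of_apply, add_mul, ← add_assoc]
    congr 1
    · rcases eq_or_ne i j with rfl | hij
      · simp [he]
      · simp [hij]
    · have hi : e i ≠ 0 := ht i
      field_simp
  have hVU : V * U = Matrix.of fun b b' => (if b = b' then 1 else ϑ) *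
      blockSum c (fun i => a i ^ 2 * t i / e i) b := by
    ext b b'
    simp only [U, V, blockSum, Matrix.mul_apply, Matrix.of_apply, ite_mul, zero_mul,
      ← Finset.sum_filter, Finset.mul_sum]
    refine Finset.sum_congr rfl fun i hi => ?_
    rw [(Finset.mem_filter.1 hi).2]
    split_ifs <;> ring
  rw [factorization, Matrix.det_mul, Matrix.det_diagonal, Matrix.det_one_add_mul_comm, hVU]

end Determinant

lemma det_one_add_blockCorr_mul_diagonal_fin_two {ι K : Type*} [Fintype ι] [DecidableEq ι]
    [Field K] (c : ι → Fin 2) (a : ι → K) (ϑ : K) {t : ι → K}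
    (ht : ∀ i, 1 + (1 - a i ^ 2) * t i ≠ 0) :
    let S := blockSum c fun i => a i ^ 2 * t i / (1 + (1 - a i ^ 2) * t i)
    (1 + blockCorr c a ϑ * Matrix.diagonal t).det =
      (∏ i, (1 + (1 - a i ^ 2) * t i)) * ((1 + S 0) * (1 + S 1) - ϑ ^ 2 * (S 0 * S 1)) := by
  rw [det_one_add_blockCorr_mul_diagonal c a ϑ ht, Matrix.det_fin_two]
  congr 1
  simp only [Matrix.add_apply, Matrix.one_apply_eq, Matrix.of_apply,
    Matrix.one_apply_ne zero_ne_one, Matrix.one_apply_ne one_ne_zero, if_true, if_neg zero_ne_one,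
    if_neg one_ne_zero]
  ring

/-! ### Uniqueness of the Laplace transform -/

/-- The exponential `x ↦ exp (-∑ i, t i * x i)` on the nonnegative orthant, as a bounded continuous
function. It is bundled as a character of the additive monoid of all `t`, so that the linear span of
these exponentials is visibly an algebra. -/
noncomputable def expNeg (ι : Type*) [Fintype ι] :
    Multiplicative (ι → ℝ≥0) →* ((ι → ℝ≥0) →ᵇ ℝ) where
  toFun t := .ofNormedAddCommGroup (fun x => Real.exp (-∑ i, (t.toAdd i * x i : ℝ))) (by fun_prop) 1
    fun x => by
      rw [Real.norm_eq_abs, Real.abs_exp, Real.exp_le_one_iff, neg_nonpos]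
      positivity
  map_one' := by ext x; simp
  map_mul' s t := by
    ext x
    simp [← Real.exp_add, add_mul, Finset.sum_add_distrib, add_comm]

lemma map_coe_map_toNNReal {ι : Type*} {μ : Measure (ι → ℝ)} (hμ : ∀ᵐ x ∂μ, ∀ i, 0 ≤ x i) :
    (μ.map fun x i => (x i).toNNReal).map (fun x i => (x i : ℝ)) = μ := by
  rw [Measure.map_map (by fun_prop) (by fun_prop)]
  conv_rhs => rw [← Measure.map_id (μ := μ)]
  refine Measure.map_congr ?_
  filter_upwards [hμ] with x hx
  ext i
  simp [hx i]

section LaplaceUniqueness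

variable {ι : Type*} [Fintype ι]

lemma expNeg_apply (t : Multiplicative (ι → ℝ≥0)) (x : ι → ℝ≥0) :
    expNeg ι t x = Real.exp (-∑ i, (t.toAdd i * x i : ℝ)) := rfl

/-- The linear span of the exponentials, as a star subalgebra. -/
noncomputable def expNegSubalgebra (ι : Type*) [Fintype ι] :
    StarSubalgebra ℝ ((ι → ℝ≥0) →ᵇ ℝ) where
  __ := Algebra.adjoin ℝ (MonoidHom.mrange (expNeg ι) : Set ((ι → ℝ≥0) →ᵇ ℝ))
  star_mem' {f} hf := by
    rwa [show star f = f by ext x; simp]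

lemma mem_expNegSubalgebra {f : (ι → ℝ≥0) →ᵇ ℝ} :
    f ∈ expNegSubalgebra ι ↔ f ∈ Submodule.span ℝ (Set.range (expNeg ι)) := by
  change f ∈ Subalgebra.toSubmodule (Algebra.adjoin ℝ (MonoidHom.mrange (expNeg ι) : Set _)) ↔ _
  rw [Algebra.adjoin_eq_span, Submonoid.closure_eq, MonoidHom.coe_mrange]

lemma separatesPoints_expNegSubalgebra :
    ((expNegSubalgebra ι).map
      (BoundedContinuousFunction.toContinuousMapStarₐ ℝ)).SeparatesPoints := by
  classical
  intro x y hxy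
  obtain ⟨i, hi⟩ := Function.ne_iff.1 hxy
  refine ⟨_, ⟨_, ⟨expNeg ι (.ofAdd (Pi.single i 1)),
    mem_expNegSubalgebra.2 (Submodule.subset_span ⟨_, rfl⟩), rfl⟩, rfl⟩, ?_⟩
  have eval : ∀ z, expNeg ι (.ofAdd (Pi.single i 1)) z = Real.exp (-z i) := fun z => by
    rw [expNeg_apply, Finset.sum_eq_single i] <;> simp +contextual
  change expNeg ι _ x ≠ expNeg ι _ y
  simpa [eval] using hi

lemma measure_ext_of_integral_expNeg {μ ν : Measure (ι → ℝ≥0)} [IsFiniteMeasure μ]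
    [IsFiniteMeasure ν] (h : ∀ t, ∫ x, expNeg ι t x ∂μ = ∫ x, expNeg ι t x ∂ν) : μ = ν := by
  refine ext_of_forall_mem_subalgebra_integral_eq_of_polish
    separatesPoints_expNegSubalgebra fun g hg => ?_
  rw [mem_expNegSubalgebra] at hg
  induction hg using Submodule.span_induction with
  | mem f hf => obtain ⟨t, rfl⟩ := hf; exact h t
  | zero => simp
  | add f g _ _ hf hg =>
    simp only [BoundedContinuousFunction.coe_add, Pi.add_apply]
    rw [integral_add (f.integrable μ) (g.integrable μ),
      integral_add (f.integrable ν) (g.integrable ν), hf, hg]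
  | smul r f _ hf =>
    simp only [BoundedContinuousFunction.coe_smul]
    rw [integral_smul, integral_smul, hf]

lemma measure_ext_of_laplace {μ ν : Measure (ι → ℝ)} [IsFiniteMeasure μ] [IsFiniteMeasure ν]
    (hμ : ∀ᵐ x ∂μ, ∀ i, 0 ≤ x i) (hν : ∀ᵐ x ∂ν, ∀ i, 0 ≤ x i)
    (h : ∀ t : ι → ℝ, (∀ i, 0 ≤ t i) →
      ∫ x, Real.exp (-∑ i, t i * x i) ∂μ = ∫ x, Real.exp (-∑ i, t i * x i) ∂ν) : μ = ν := by
  have transfer : ∀ {ρ : Measure (ι → ℝ)}, (∀ᵐ x ∂ρ, ∀ i, 0 ≤ x i) → ∀ t,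
      ∫ x, expNeg ι t x ∂ρ.map (fun x i => (x i).toNNReal) =
        ∫ x, Real.exp (-∑ i, (t.toAdd i * x i : ℝ)) ∂ρ := fun {ρ} hρ t => by
    rw [integral_map (Measurable.aemeasurable (by fun_prop))
      (expNeg ι t).continuous.aestronglyMeasurable]
    refine integral_congr_ae ?_
    filter_upwards [hρ] with x hx
    simp [expNeg_apply, hx]
  rw [← map_coe_map_toNNReal hμ, ← map_coe_map_toNNReal hν]
  congr 1
  refine measure_ext_of_integral_expNeg fun t => ?_
  rw [transfer hμ, transfer hν]
  exact h _ fun i => (t.toAdd i).2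

end LaplaceUniqueness

/-! ### The multivariate gamma law as a mixture -/

/-- The mixture of products of gamma laws with rates `r i` and shapes `α + u.2 i` in which `u` is
drawn with the weights `C * mixWeight c α θ p u`. -/
noncomputable def gammaMixture {ι : Type*} [Fintype ι] (c : ι → Fin 2) (C α θ : ℝ) (p r : ι → ℝ) :
    Measure (ι → ℝ) :=
  productMixture (fun u => C * mixWeight c α θ p u) fun u i => gammaMeasure (α + u.2 i) (r i)

section GammaMixture

variable {ι : Type*} [Fintype ι] (c : ι → Fin 2) {C α θ : ℝ} {p r : ι → ℝ}

lemma ae_nonneg_gammaMixture (hα : 0 < α) (hr : ∀ i, 0 < r i) :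
    ∀ᵐ x ∂gammaMixture c C α θ p r, ∀ i, 0 ≤ x i :=
  ae_productMixture fun _ => (ae_pos_pi_gammaMeasure (fun _ => by positivity) hr).mono
    fun _ hx i => (hx i).le

lemma lintegral_exp_neg_gammaMixture (hC : 0 ≤ C) (hα : 0 < α) (hθ : 0 ≤ θ) (hp : ∀ i, 0 ≤ p i)
    (hr : ∀ i, 0 < r i) {t z : ι → ℝ} (ht : ∀ i, 0 ≤ t i) (hz : ∀ i, z i = r i / (r i + t i))
    (hpz : ∀ b, blockSum c (p * z) b < 1) (hθ_lt : θ < ∏ b, (1 - blockSum c (p * z) b)) :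
    ∫⁻ x, ENNReal.ofReal (Real.exp (-∑ i, t i * x i)) ∂gammaMixture c C α θ p r =
      ENNReal.ofReal (C * Real.Gamma α * (∏ i, z i) ^ α *
        (∏ b, (1 - blockSum c (p * z) b) - θ) ^ (-α)) := by
  have z_pos : ∀ i, 0 < z i := fun i =>
    hz i ▸ div_pos (hr i) (add_pos_of_pos_of_nonneg (hr i) (ht i))
  have shape_pos : ∀ (u : ℕ × (ι → ℕ)) i, 0 < α + u.2 i := fun u i => by positivity
  have := fun (u : ℕ × (ι → ℕ)) i => isProbabilityMeasure_gammaMeasure (shape_pos u i) (hr i)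
  have coeff_nonneg : 0 ≤ C * (∏ i, z i) ^ α :=
    mul_nonneg hC (Real.rpow_nonneg (Finset.prod_nonneg fun i _ => (z_pos i).le) _)
  have term : ∀ u : ℕ × (ι → ℕ), ENNReal.ofReal (C * mixWeight c α θ p u) *
      ∏ i, ∫⁻ x, ENNReal.ofReal (Real.exp (-(t i * x))) ∂gammaMeasure (α + u.2 i) (r i) =
      ENNReal.ofReal (C * (∏ i, z i) ^ α) *
        ENNReal.ofReal (mixWeight c α θ p u * ∏ i, z i ^ u.2 i) := fun u => by
    simp only [lintegral_exp_neg_mul_gammaMeasure (shape_pos u _) (hr _)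
      (add_pos_of_pos_of_nonneg (hr _) (ht _)), ← hz]
    rw [← ENNReal.ofReal_prod_of_nonneg fun i _ => Real.rpow_nonneg (z_pos i).le _,
      ← ENNReal.ofReal_mul (mul_nonneg hC (mixWeight_nonneg c hα hθ hp u)),
      ← ENNReal.ofReal_mul coeff_nonneg, ← Real.finsetProd_rpow _ _ fun i _ => (z_pos i).le]
    simp only [Real.rpow_add (z_pos _), Real.rpow_natCast, Finset.prod_mul_distrib]
    ring_nf
  simp only [← Finset.sum_neg_distrib, Real.exp_sum,
    ENNReal.ofReal_prod_of_nonneg fun _ _ => (Real.exp_pos _).le]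
  rw [gammaMixture, lintegral_prod_productMixture
    (fun i x => ENNReal.ofReal (Real.exp (-(t i * x)))) fun i => by fun_prop]
  simp only [term]
  rw [ENNReal.tsum_mul_left, tsum_mixWeight_mul_prod_pow c hα hθ hp (fun i => (z_pos i).le) hpz
    hθ_lt, ← ENNReal.ofReal_mul coeff_nonneg]
  ring_nf

variable [IsFiniteMeasure (gammaMixture c C α θ p r)]

lemma logSupermodular_boxMass_gammaMixture (hC : 0 ≤ C) (hα : 0 < α) (hθ : 0 ≤ θ)
    (hp : ∀ i, 0 ≤ p i) (hr : ∀ i, 0 < r i) :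
    LogSupermodular (boxMass (gammaMixture c C α θ p r)) := by
  have := fun (u : ℕ × (ι → ℕ)) i =>
    isProbabilityMeasure_gammaMeasure (show 0 < α + u.2 i by positivity) (hr i)
  have : IsFiniteMeasure (productMixture (fun u => C * mixWeight c α θ p u)
    fun u i => gammaMeasure (α + u.2 i) (r i)) := ‹IsFiniteMeasure (gammaMixture c C α θ p r)›
  have weight_nonneg := mixWeight_nonneg c hα hθ hp
  refine logSupermodular_boxMass_productMixture ?_ (fun u => mul_nonneg hC (weight_nonneg u))
    fun i => (logSupermodular_gammaMeasure hα (hr i)).comp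
      (g := fun x : (ℕ × (ι → ℕ)) × LowerSet ℝ => (x.1.2 i, x.2)) (fun _ _ => rfl) fun _ _ => rfl
  exact .mul (fun _ _ => le_rfl) (logSupermodular_mixWeight c hα hθ hp) (fun _ => hC) weight_nonneg

lemma boxMass_gammaMixture_pos (hC : 0 < C) (hα : 0 < α) (hθ : 0 ≤ θ) (hp : ∀ i, 0 ≤ p i)
    (hr : ∀ i, 0 < r i) {x : ι → ℝ} (hx : ∀ i, 0 < x i) :
    0 < boxMass (gammaMixture c C α θ p r) fun i => .Iic (x i) := by
  have := fun (u : ℕ × (ι → ℕ)) i =>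
    isProbabilityMeasure_gammaMeasure (show 0 < α + u.2 i by positivity) (hr i)
  have : IsFiniteMeasure (productMixture (fun u => C * mixWeight c α θ p u)
    fun u i => gammaMeasure (α + u.2 i) (r i)) := ‹IsFiniteMeasure (gammaMixture c C α θ p r)›
  exact boxMass_productMixture_pos (fun u => mul_nonneg hC.le (mixWeight_nonneg c hα hθ hp u))
    (mul_pos hC (mixWeight_zero_pos c hα)) fun i =>
      gammaMeasure_Iic_pos (by positivity) (hr i) (hx i)

end GammaMixture

/-- The denominators of the parameters of the gamma mixture with matrix `blockCorr c a ϑ`, one for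
each block: the limits as `t → ∞` of the factors `1 + (1 - ϑ ^ 2) * S b`, where `S b` is the
block sum in `det (1 + blockCorr c a ϑ * T)`. -/
noncomputable def blockScale {ι κ : Type*} [Fintype ι] [DecidableEq κ] (c : ι → κ) (a : ι → ℝ)
    (ϑ : ℝ) (b : κ) : ℝ :=
  1 + (1 - ϑ ^ 2) * blockSum c (fun i => a i ^ 2 / (1 - a i ^ 2)) b

/-- The weight parameters `p` of the gamma mixture with matrix `blockCorr c a ϑ`. -/
noncomputable def blockRate {ι κ : Type*} [Fintype ι] [DecidableEq κ] (c : ι → κ) (a : ι → ℝ)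
    (ϑ : ℝ) (i : ι) : ℝ :=
  (1 - ϑ ^ 2) * (a i ^ 2 / (1 - a i ^ 2)) / blockScale c a ϑ (c i)

/-- The multivariate gamma law with Laplace transform `det (1 + blockCorr c a ϑ * T) ^ (-α)`,
realized as a mixture of products of gamma laws. -/
noncomputable def blockGamma {ι : Type*} [Fintype ι] (c : ι → Fin 2) (a : ι → ℝ) (ϑ α : ℝ) :
    Measure (ι → ℝ) :=
  gammaMixture c (((1 - ϑ ^ 2) / ∏ b, blockScale c a ϑ b) ^ α / Real.Gamma α) α
    (ϑ ^ 2 / ∏ b, blockScale c a ϑ b) (blockRate c a ϑ) fun i => (1 - a i ^ 2)⁻¹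

lemma rpow_mul_mul_rpow_neg {x y α : ℝ} (hx : 0 < x) (hy : 0 ≤ y) :
    x ^ α * (x * y) ^ (-α) = y ^ (-α) := by
  rw [Real.mul_rpow hx.le hy, ← mul_assoc, ← Real.rpow_add hx, add_neg_cancel, Real.rpow_zero,
    one_mul]

lemma one_sub_sq_pos {x : ℝ} (hx : |x| < 1) : 0 < 1 - x ^ 2 :=
  sub_pos.2 ((sq_lt_one_iff_abs_lt_one x).2 hx)

lemma one_add_one_sub_sq_mul_pos {x y : ℝ} (hx : |x| < 1) (hy : 0 ≤ y) :
    0 < 1 + (1 - x ^ 2) * y :=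
  add_pos_of_pos_of_nonneg one_pos (mul_nonneg (one_sub_sq_pos hx).le hy)

section Parameters

variable {ι κ : Type*} [Fintype ι] [DecidableEq κ] (c : ι → κ) {a t : ι → ℝ} {ϑ : ℝ}

lemma blockSum_nonneg {x : ι → ℝ} (hx : ∀ i, 0 ≤ x i) (b : κ) : 0 ≤ blockSum c x b :=
  Finset.sum_nonneg fun i _ => hx i

lemma blockSum_div_nonneg (ha : ∀ i, |a i| < 1) (ht : ∀ i, 0 ≤ t i) (b : κ) :
    0 ≤ blockSum c (fun i => a i ^ 2 * t i / (1 + (1 - a i ^ 2) * t i)) b :=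
  blockSum_nonneg c (fun i => div_nonneg (mul_nonneg (sq_nonneg _) (ht i))
    (one_add_one_sub_sq_mul_pos (ha i) (ht i)).le) b

lemma blockScale_pos (ha : ∀ i, |a i| < 1) (hϑ : |ϑ| < 1) (b : κ) : 0 < blockScale c a ϑ b :=
  add_pos_of_pos_of_nonneg one_pos (mul_nonneg (one_sub_sq_pos hϑ).le
    (blockSum_nonneg c (fun i => div_nonneg (sq_nonneg _) (one_sub_sq_pos (ha i)).le) b))

lemma prod_blockScale_pos [Fintype κ] (ha : ∀ i, |a i| < 1) (hϑ : |ϑ| < 1) :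
    0 < ∏ b, blockScale c a ϑ b :=
  Finset.prod_pos fun b _ => blockScale_pos c ha hϑ b

lemma blockRate_nonneg (ha : ∀ i, |a i| < 1) (hϑ : |ϑ| < 1) (i : ι) : 0 ≤ blockRate c a ϑ i :=
  div_nonneg (mul_nonneg (one_sub_sq_pos hϑ).le
    (div_nonneg (sq_nonneg _) (one_sub_sq_pos (ha i)).le)) (blockScale_pos c ha hϑ _).le

lemma one_sub_blockSum_blockRate_mul (ha : ∀ i, |a i| < 1) (hϑ : |ϑ| < 1) (ht : ∀ i, 0 ≤ t i)
    (b : κ) :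
    1 - blockSum c (blockRate c a ϑ * fun i => (1 + (1 - a i ^ 2) * t i)⁻¹) b =
      (1 + (1 - ϑ ^ 2) * blockSum c (fun i => a i ^ 2 * t i / (1 + (1 - a i ^ 2) * t i)) b) /
        blockScale c a ϑ b := by
  have hK := (blockScale_pos c ha hϑ b).ne'
  have term : ∀ i ∈ Finset.univ.filter (c · = b),
      (blockRate c a ϑ * fun j => (1 + (1 - a j ^ 2) * t j)⁻¹ : ι → ℝ) i =
        (1 - ϑ ^ 2) / blockScale c a ϑ b *
          (a i ^ 2 / (1 - a i ^ 2) - a i ^ 2 * t i / (1 + (1 - a i ^ 2) * t i)) := fun i hi => by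
    have hd := (one_sub_sq_pos (ha i)).ne'
    have he := (one_add_one_sub_sq_mul_pos (ha i) (ht i)).ne'
    rw [Pi.mul_apply, blockRate, (Finset.mem_filter.1 hi).2]
    field_simp
    ring
  rw [blockSum, Finset.sum_congr rfl term, ← Finset.mul_sum, Finset.sum_sub_distrib, eq_div_iff hK,
    sub_mul, one_mul, mul_right_comm, div_mul_cancel₀ _ hK, blockScale, blockSum, blockSum]
  ring

end Parameters

section BlockGamma

variable {ι : Type*} [Fintype ι] [DecidableEq ι] (c : ι → Fin 2) {a t : ι → ℝ} {ϑ α : ℝ}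

lemma det_one_add_blockCorr_mul_diagonal_pos (ha : ∀ i, |a i| < 1) (hϑ : |ϑ| < 1)
    (ht : ∀ i, 0 ≤ t i) : 0 < (1 + blockCorr c a ϑ * Matrix.diagonal t).det := by
  have he := fun i => one_add_one_sub_sq_mul_pos (ha i) (ht i)
  have hS := blockSum_div_nonneg c ha ht
  rw [det_one_add_blockCorr_mul_diagonal_fin_two c a ϑ fun i => (he i).ne']
  refine mul_pos (Finset.prod_pos fun i _ => he i) ?_
  nlinarith [hS 0, hS 1, mul_nonneg (one_sub_sq_pos hϑ).le (mul_nonneg (hS 0) (hS 1))]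

lemma prod_one_sub_blockSum_blockRate_mul_sub (ha : ∀ i, |a i| < 1) (hϑ : |ϑ| < 1)
    (ht : ∀ i, 0 ≤ t i) :
    ∏ b, (1 - blockSum c (blockRate c a ϑ * fun i => (1 + (1 - a i ^ 2) * t i)⁻¹) b) -
        ϑ ^ 2 / ∏ b, blockScale c a ϑ b =
      (1 - ϑ ^ 2) / (∏ b, blockScale c a ϑ b) * ((∏ i, (1 + (1 - a i ^ 2) * t i)⁻¹) *
        (1 + blockCorr c a ϑ * Matrix.diagonal t).det) := by
  have he := fun i => (one_add_one_sub_sq_mul_pos (ha i) (ht i)).ne'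
  have hK := fun b => (blockScale_pos c ha hϑ b).ne'
  rw [det_one_add_blockCorr_mul_diagonal_fin_two c a ϑ he, ← mul_assoc (∏ i, _),
    ← Finset.prod_mul_distrib, Finset.prod_eq_one fun i _ => inv_mul_cancel₀ (he i), one_mul]
  simp only [one_sub_blockSum_blockRate_mul c ha hϑ ht, Fin.prod_univ_two]
  field_simp [hK 0, hK 1]
  ring

lemma lintegral_exp_neg_blockGamma (ha : ∀ i, |a i| < 1) (hϑ : |ϑ| < 1) (hα : 0 < α)
    (ht : ∀ i, 0 ≤ t i) :
    ∫⁻ x, ENNReal.ofReal (Real.exp (-∑ i, t i * x i)) ∂blockGamma c a ϑ α =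
      ENNReal.ofReal ((1 + blockCorr c a ϑ * Matrix.diagonal t).det ^ (-α)) := by
  have he := fun i => one_add_one_sub_sq_mul_pos (ha i) (ht i)
  have hd := fun i => one_sub_sq_pos (ha i)
  have hq := one_sub_sq_pos hϑ
  have hΓ := Real.Gamma_pos_of_pos hα
  have hK := prod_blockScale_pos c ha hϑ
  have hk : 0 < (1 - ϑ ^ 2) / ∏ b, blockScale c a ϑ b := div_pos hq hK
  have hz : 0 < ∏ i, (1 + (1 - a i ^ 2) * t i)⁻¹ := Finset.prod_pos fun i _ => inv_pos.2 (he i)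
  have hdet := det_one_add_blockCorr_mul_diagonal_pos c ha hϑ ht
  have transform := prod_one_sub_blockSum_blockRate_mul_sub c ha hϑ ht
  have rate : ∀ i, (1 + (1 - a i ^ 2) * t i)⁻¹ =
      (1 - a i ^ 2)⁻¹ / ((1 - a i ^ 2)⁻¹ + t i) := fun i => by
    have := (hd i).ne'
    rw [inv_eq_one_div, inv_eq_one_div, div_add' _ _ _ this, div_div_div_cancel_right₀ this,
      mul_comm (t i)]
  have blockSum_lt : ∀ b,
      blockSum c (blockRate c a ϑ * fun i => (1 + (1 - a i ^ 2) * t i)⁻¹) b < 1 := fun b => by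
    have := mul_nonneg hq.le (blockSum_div_nonneg c ha ht b)
    rw [← sub_pos, one_sub_blockSum_blockRate_mul c ha hϑ ht]
    exact div_pos (by linarith) (blockScale_pos c ha hϑ b)
  have index_lt : ϑ ^ 2 / ∏ b, blockScale c a ϑ b <
      ∏ b, (1 - blockSum c (blockRate c a ϑ * fun i => (1 + (1 - a i ^ 2) * t i)⁻¹) b) :=
    sub_pos.1 (transform ▸ mul_pos hk (mul_pos hz hdet))
  rw [blockGamma, lintegral_exp_neg_gammaMixture c (by positivity) hα (by positivity)
    (blockRate_nonneg c ha hϑ) (fun i => inv_pos.2 (hd i)) ht rate blockSum_lt index_lt, transform,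
    div_mul_cancel₀ _ hΓ.ne', ← Real.mul_rpow hk.le hz.le, ← mul_assoc,
    rpow_mul_mul_rpow_neg (mul_pos hk hz) hdet.le]

omit [DecidableEq ι] in
lemma isProbabilityMeasure_blockGamma (ha : ∀ i, |a i| < 1) (hϑ : |ϑ| < 1) (hα : 0 < α) :
    IsProbabilityMeasure (blockGamma c a ϑ α) := by
  classical
  refine ⟨?_⟩
  simpa using lintegral_exp_neg_blockGamma c ha hϑ hα (t := 0) fun _ => le_rfl

lemma integral_exp_neg_blockGamma (ha : ∀ i, |a i| < 1) (hϑ : |ϑ| < 1) (hα : 0 < α)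
    (ht : ∀ i, 0 ≤ t i) :
    ∫ x, Real.exp (-∑ i, t i * x i) ∂blockGamma c a ϑ α =
      (1 + blockCorr c a ϑ * Matrix.diagonal t).det ^ (-α) := by
  rw [integral_eq_lintegral_of_nonneg_ae (.of_forall fun _ => (Real.exp_pos _).le)
      (Measurable.aestronglyMeasurable (by fun_prop)),
    lintegral_exp_neg_blockGamma c ha hϑ hα ht, ENNReal.toReal_ofReal
      (Real.rpow_nonneg (det_one_add_blockCorr_mul_diagonal_pos c ha hϑ ht).le _)]

omit [DecidableEq ι]

lemma logSupermodular_boxMass_blockGamma (ha : ∀ i, |a i| < 1) (hϑ : |ϑ| < 1) (hα : 0 < α) :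
    LogSupermodular (boxMass (blockGamma c a ϑ α)) := by
  have := isProbabilityMeasure_blockGamma c ha hϑ hα
  unfold blockGamma at *
  have hK := prod_blockScale_pos c ha hϑ
  have hq := one_sub_sq_pos hϑ
  exact logSupermodular_boxMass_gammaMixture c (by positivity) hα (by positivity)
    (blockRate_nonneg c ha hϑ) fun i => inv_pos.2 (one_sub_sq_pos (ha i))

lemma boxMass_blockGamma_pos (ha : ∀ i, |a i| < 1) (hϑ : |ϑ| < 1) (hα : 0 < α) {x : ι → ℝ}
    (hx : ∀ i, 0 < x i) : 0 < boxMass (blockGamma c a ϑ α) fun i => .Iic (x i) := by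
  have := isProbabilityMeasure_blockGamma c ha hϑ hα
  unfold blockGamma at *
  have hK := prod_blockScale_pos c ha hϑ
  have hq := one_sub_sq_pos hϑ
  exact boxMass_gammaMixture_pos c (by positivity) hα (by positivity)
    (blockRate_nonneg c ha hϑ) (fun i => inv_pos.2 (one_sub_sq_pos (ha i))) hx

end BlockGamma

/-! ### Distribution functions -/

section Cdf

variable {n : ℕ} {μ : Measure (Fin n → ℝ)} {D : Set (Fin n → ℝ)} (I : Finset (Fin n))
  {x b : Fin n → ℝ}

lemma jointCdf_eq_boxMass : jointCdf μ x = boxMass μ fun i => .Iic (x i) := rfl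

lemma partialCdf_eq_boxMass :
    partialCdf μ I x = boxMass μ fun i => if i ∈ I then .Iic (x i) else ⊤ := by
  have mem_iff : ∀ (ω : Fin n → ℝ) i,
      ω i ∈ (if i ∈ I then .Iic (x i) else ⊤ : LowerSet ℝ) ↔ (i ∈ I → ω i ≤ x i) := fun ω i => by
    split_ifs with hi <;> simp [hi]
  simp only [partialCdf, boxMass, mem_iff]

lemma jointCdf_le_partialCdf [IsFiniteMeasure μ] : jointCdf μ x ≤ partialCdf μ I x :=
  measureReal_mono fun _ hω i _ => hω i

lemma isMTP2On_jointCdf (hμ : LogSupermodular (boxMass μ)) (pos : ∀ x ∈ D, 0 < jointCdf μ x) :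
    IsMTP2On D (jointCdf μ) := by
  refine ⟨pos, fun x _ y _ => ?_⟩
  have Iic_mono : Monotone (LowerSet.Iic : ℝ → LowerSet ℝ) := fun _ _ h => LowerSet.Iic_le.2 h
  rw [mul_comm (jointCdf μ (x ⊔ y))]
  exact hμ.comp (g := fun (x : Fin n → ℝ) i => LowerSet.Iic (x i))
    (fun x y => funext fun i => Iic_mono.map_inf (x i) (y i))
    (fun x y => funext fun i => Iic_mono.map_sup (x i) (y i)) x y

lemma jointCdf_mul_partialCdf_mul_partialCdf_compl_le (hμ : LogSupermodular (boxMass μ))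
    (hxb : x ≤ b) :
    jointCdf μ b * (partialCdf μ I x * partialCdf μ Iᶜ x) ≤
      jointCdf μ x * (partialCdf μ I b * partialCdf μ Iᶜ b) := by
  let box (J : Finset (Fin n)) (y : Fin n → ℝ) (i : Fin n) : LowerSet ℝ :=
    if i ∈ J then .Iic (y i) else ⊤
  have box_mono : ∀ J, box J x ≤ box J b := fun J i => by
    simp only [box]
    split_ifs
    exacts [LowerSet.Iic_le.2 (hxb i), le_rfl]
  have box_inf : ∀ y, box I y ⊓ box Iᶜ y = fun i => .Iic (y i) := fun y => by
    ext1 i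
    by_cases hi : i ∈ I <;> simp [box, hi]
  have box_codisjoint : Codisjoint (box I x) (box Iᶜ x) := codisjoint_iff.2 <| by
    ext1 i
    by_cases hi : i ∈ I <;> simp [box, hi]
  simpa only [jointCdf_eq_boxMass, partialCdf_eq_boxMass, box_inf] using
    hμ.mul_le_mul_of_codisjoint (fun _ => measureReal_nonneg) box_codisjoint (box_mono I)
      (box_mono Iᶜ)

end Cdf

lemma IsMultivariateGamma.unique {n : ℕ} {α : ℝ} {R : Matrix (Fin n) (Fin n) ℝ}
    {μ ν : Measure (Fin n → ℝ)} (hμ : IsMultivariateGamma α R μ) (hν : IsMultivariateGamma α R ν) :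
    μ = ν := by
  have := hμ.isProbabilityMeasure
  have := hν.isProbabilityMeasure
  exact measure_ext_of_laplace hμ.ae_nonneg hν.ae_nonneg fun t ht =>
    (hμ.laplace t ht).trans (hν.laplace t ht).symm

lemma blockFactorCorr_eq_blockCorr {n : ℕ} (n₁ : ℕ) (a : Fin n → ℝ) (ϑ : ℝ) :
    blockFactorCorr n₁ a ϑ =
      blockCorr (fun i : Fin n => if (i : ℕ) < n₁ then (0 : Fin 2) else 1) a ϑ := by
  have same_block : ∀ i j : Fin n, ((if (i : ℕ) < n₁ then (0 : Fin 2) else 1) =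
      if (j : ℕ) < n₁ then 0 else 1) ↔ ((i : ℕ) < n₁ ↔ (j : ℕ) < n₁) := fun i j => by
    by_cases hi : (i : ℕ) < n₁ <;> by_cases hj : (j : ℕ) < n₁ <;> simp [hi, hj]
  simp only [blockFactorCorr, blockCorr, same_block]

lemma isMultivariateGamma_blockGamma {n : ℕ} (c : Fin n → Fin 2) {a : Fin n → ℝ} {ϑ α : ℝ}
    (ha : ∀ i, |a i| < 1) (hϑ : |ϑ| < 1) (hα : 0 < α) :
    IsMultivariateGamma α (blockCorr c a ϑ) (blockGamma c a ϑ α) where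
  isProbabilityMeasure := isProbabilityMeasure_blockGamma c ha hϑ hα
  ae_nonneg := ae_nonneg_gammaMixture c hα fun i => inv_pos.2 (one_sub_sq_pos (ha i))
  laplace _ ht := integral_exp_neg_blockGamma c ha hϑ hα ht

theorem mainTheorem7_general {n : ℕ} (c : Fin n → Fin 2) (a : Fin n → ℝ) (ha : ∀ i, |a i| < 1)
    (ϑ : ℝ) (hϑ : |ϑ| < 1) (α : ℝ) (hα : 0 < α) :
    (∃! μ : Measure (Fin n → ℝ), IsMultivariateGamma α (blockCorr c a ϑ) μ) ∧
    ∀ μ : Measure (Fin n → ℝ), IsMultivariateGamma α (blockCorr c a ϑ) μ →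
      IsMTP2On (Set.univ.pi fun _ => Set.Ioi (0 : ℝ)) (jointCdf μ) ∧
      ∀ x b : Fin n → ℝ, (∀ i, 0 < b i) → (∀ i, x i ≤ b i) → ∀ I : Finset (Fin n),
        partialCdf μ I x * partialCdf μ Iᶜ x / (partialCdf μ I b * partialCdf μ Iᶜ b)
            ≤ jointCdf μ x / jointCdf μ b ∧
        ((∀ i, 0 < x i) →
          jointCdf μ b / (partialCdf μ I b * partialCdf μ Iᶜ b)
            ≤ jointCdf μ x / (partialCdf μ I x * partialCdf μ Iᶜ x)) := by
  have gamma := isMultivariateGamma_blockGamma c ha hϑ hα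
  refine ⟨⟨_, gamma, fun ν hν => hν.unique gamma⟩, fun μ hμ => ?_⟩
  obtain rfl := hμ.unique gamma
  have := hμ.isProbabilityMeasure
  have supermodular := logSupermodular_boxMass_blockGamma c ha hϑ hα
  have joint_pos : ∀ y : Fin n → ℝ, (∀ i, 0 < y i) → 0 < jointCdf _ y := fun y hy =>
    boxMass_blockGamma_pos c ha hϑ hα hy
  have partial_pos : ∀ y : Fin n → ℝ, (∀ i, 0 < y i) → ∀ J, 0 < partialCdf _ J y :=
    fun y hy J => (joint_pos y hy).trans_le (jointCdf_le_partialCdf J)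
  refine ⟨isMTP2On_jointCdf supermodular fun y hy => joint_pos y fun i => hy i trivial,
    fun x b hb hxb I => ?_⟩
  have key := jointCdf_mul_partialCdf_mul_partialCdf_compl_le I supermodular hxb
  have partial_b_pos := mul_pos (partial_pos b hb I) (partial_pos b hb Iᶜ)
  refine ⟨?_, fun hx => ?_⟩
  · rw [div_le_div_iff₀ partial_b_pos (joint_pos b hb), mul_comm]
    exact key
  · rwa [div_le_div_iff₀ partial_b_pos (mul_pos (partial_pos x hx I) (partial_pos x hx Iᶜ))]

theorem mainTheorem7 (n n₁ : ℕ) (hn₁ : 1 < n₁) (hn : n₁ + 1 < n)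
    (a : Fin n → ℝ) (ha : ∀ i, |a i| < 1) (ϑ : ℝ) (hϑ : |ϑ| < 1) (α : ℝ) (hα : 0 < α) :
    (∃! μ : Measure (Fin n → ℝ), IsMultivariateGamma α (blockFactorCorr n₁ a ϑ) μ) ∧
    ∀ μ : Measure (Fin n → ℝ), IsMultivariateGamma α (blockFactorCorr n₁ a ϑ) μ →
      IsMTP2On (Set.univ.pi fun _ => Set.Ioi (0 : ℝ)) (jointCdf μ) ∧
      ∀ x b : Fin n → ℝ, (∀ i, 0 < b i) → (∀ i, x i ≤ b i) →
        ∀ I : Finset (Fin n), I.Nonempty →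
          partialCdf μ I x * partialCdf μ Iᶜ x / (partialCdf μ I b * partialCdf μ Iᶜ b)
              ≤ jointCdf μ x / jointCdf μ b ∧
          ((∀ i, 0 < x i) →
            jointCdf μ b / (partialCdf μ I b * partialCdf μ Iᶜ b)
              ≤ jointCdf μ x / (partialCdf μ I x * partialCdf μ Iᶜ x)) := by
  rw [blockFactorCorr_eq_blockCorr]
  obtain ⟨exists_unique, cdf⟩ := mainTheorem7_general _ a ha ϑ hϑ α hα
  exact ⟨exists_unique, fun μ hμ => ⟨(cdf μ hμ).1, fun x b hb hxb I _ => (cdf μ hμ).2 x b hb hxb I⟩⟩
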